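/- Let $M$ be a smooth manifold, $\phi\colon M\to M$ a smooth map, and write $\phi^*f=f\circ\phi$. All vector bundles are real, smooth and of finite rank; $\Gamma$ denotes smooth sections. A \emph{hom-bundle} $(E,\phi,\beta)$ over $M$ is a vector bundle $E\to M$ with a linear map $\beta\colon\Gamma E\to\Gamma E$ such that $\beta(fs)=\phi^*(f)\,\beta(s)$ for $f\in C^\infty(M)$, $s\in\Gamma E$. A \emph{hom-Lie algebroid} $\mathcal A=(A,\phi,[-,-],\rho,\alpha)$ is a hom-bundle $(A,\phi,\alpha)$ with an $\mathbb R$-bilinear bracket on $\Gamma A$ and a bundle map $\rho\colon\phi^!A\to\phi^!TM$ between the pulled-back bundles, giving $\rho(x)[f](m)=\langle d_{\phi(m)}f,\rho_m(x_{\phi(m)})\rangle$, such that (i) $(\Gamma A,[-,-],\alpha)$ is a hom-Lie algebra: $[-,-]$ is skew-symmetric, $\alpha[x,y]=[\alpha x,\alpha y]$ and $[\alpha(x),[y,z]]+[\alpha(y),[z,x]]+[\alpha(z),[x,y]]=0$; (ii) $[x,fy]=\phi^*(f)[x,y]+\rho(x)[f]\,\alpha(y)$; (iii) $(\rho,\phi^*)$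 is a representation of the hom-Lie algebra $\Gamma A$ on $C^\infty(M)$. Here a \emph{representation} of a hom-Lie algebra $(\mathfrak g,[-,-],\alpha)$ on a vector space $V$ is a pair of linear maps $\theta\colon\mathfrak g\to\mathfrak{gl}(V)$, $\alpha_V\colon V\to V$ with $\theta(\alpha(x))\circ\alpha_V=\alpha_V\circ\theta(x)$ and $\theta([x,y])\circ\alpha_V=\theta(\alpha(x))\circ\theta(y)-\theta(\alpha(y))\circ\theta(x)$. A \emph{representation of $\mathcal A$ on a hom-bundle} $(E,\phi,\beta)$ is an $\mathbb R$-bilinear map $\nabla\colon\Gamma A\times\Gamma E\to\Gamma E$ with $\nabla(fx,s)=\phi^*(f)\nabla(x,s)$ and $\nabla(x,fs)=\phi^*(f)\nabla(x,s)+\rho(x)[f]\,\beta(s)$ such that $(\nabla,\beta)$ is a representation of the hom-Lie algebra $\Gamma A$ on $\Gamma E$. \textbf{Proposition.} Let $\mathcal A=(A,\phi,[-,-],\rho,\alpha)$ be a hom-Lie algebroid and $(E,\phi,\beta)$ a hom-bundle over $M$, where $E$ is a line bundle and $\beta$ is fibrewise invertible, i.e. $\beta(t)(m)\neq0$ whenever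 $t\in\Gamma E$ and $t(\phi(m))\ne0$ (this holds for instance if $\beta$ is bijective). Let $(E\otimes E,\phi,\bar\beta)$ be the square hom-bundle, $\bar\beta=\beta\otimes\beta$, so $\bar\beta(s\otimes t)=\beta(s)\otimes\beta(t)$, and let $\bar\nabla$ be a representation of $\mathcal A$ on $(E\otimes E,\phi,\bar\beta)$. Write $t^2=t\otimes t$. Then $\bar\beta(t^2)(m)\ne0$ whenever $t(\phi(m))\neq 0$, and there is exactly one map $\nabla\colon\Gamma A\times\Gamma E\to\Gamma E$ such that for every $x\in\Gamma A$, $s\in\Gamma E$, every open $U\subseteq M$, $f\in C^\infty(U)$ and $t\in\Gamma E$ vanishing nowhere on $U$ with $s=f\,t$ on $U$, $$\nabla(x,s)\big|_{\phi^{-1}(U)}=\Big(\rho(x)[f]\,\beta(t)+\tfrac12\,\frac{\bar\nabla(x,t^2)}{\bar\beta(t^2)}\,\beta(s)\Big)\Big|_{\phi^{-1}(U)},$$ where the quotient of two sections of the line bundle $E\otimes E$, the second one nowhere zero, is a function. This $\nabla$ is a representation of $\mathcal A$ on $(E,\phi,\beta)$, and for all $x\in\Gamma A$, $s_1,s_2\in\Gamma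 E$, $$\bar\nabla(x,s_1\otimes s_2)=\nabla(x,s_1)\otimes\beta(s_2)+\beta(s_1)\otimes\nabla(x,s_2).$$ -/

import Mathlib

open Bundle Set Topology
open scoped Manifold ContDiff TensorProduct

set_option linter.unusedSectionVars false

noncomputable section

namespace HomAlgebroid

/-! ### Hom-Lie algebras and their representations (over `ℝ`) -/

section HomLie

variable {𝔤 V : Type*} [AddCommGroup 𝔤] [Module ℝ 𝔤] [AddCommGroup V] [Module ℝ V]

/-- `(𝔤, [-,-], α)` is a hom-Lie algebra. -/
structure IsHomLieAlgebra (br : 𝔤 →ₗ[ℝ] 𝔤 →ₗ[ℝ] 𝔤) (α : 𝔤 →ₗ[ℝ] 𝔤) : Prop where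
  skew : ∀ x y, br x y = -br y x
  map_bracket : ∀ x y, α (br x y) = br (α x) (α y)
  jacobi : ∀ x y z, br (α x) (br y z) + br (α y) (br z x) + br (α z) (br x y) = 0

/-- `(ρ, αV)` is a representation of the hom-Lie algebra `(𝔤, [-,-], α)` on `V`. -/
structure IsHomLieRep (br : 𝔤 →ₗ[ℝ] 𝔤 →ₗ[ℝ] 𝔤) (α : 𝔤 →ₗ[ℝ] 𝔤)
    (ρ : 𝔤 →ₗ[ℝ] V →ₗ[ℝ] V) (αV : V →ₗ[ℝ] V) : Prop where
  equivariant : ∀ x v, ρ (α x) (αV v) = αV (ρ x v)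
  bracket : ∀ x y v, ρ (br x y) (αV v) = ρ (α x) (ρ y v) - ρ (α y) (ρ x v)

end HomLie

/-! ### Smooth sections, hom-bundles, hom-Lie algebroids -/

section Bundles

variable {EM : Type*} [NormedAddCommGroup EM] [NormedSpace ℝ EM]
  {M : Type*} [TopologicalSpace M] [ChartedSpace EM M]

/-- The algebra `C^∞(M)`. -/
abbrev SmoothFun (EM M : Type*) [NormedAddCommGroup EM] [NormedSpace ℝ EM]
    [TopologicalSpace M] [ChartedSpace EM M] : Type _ :=
  C^∞⟮𝓘(ℝ, EM), M; 𝓘(ℝ, ℝ), ℝ⟯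

/-- The pull-back `φ^* : C^∞(M) → C^∞(M)`. -/
def pullback (φ : C^∞⟮𝓘(ℝ, EM), M; 𝓘(ℝ, EM), M⟯) : SmoothFun EM M →ₗ[ℝ] SmoothFun EM M where
  toFun f := f.comp φ
  map_add' _ _ := rfl
  map_smul' _ _ := rfl

section OneBundle

variable (EM)
variable (F : Type*) [NormedAddCommGroup F] [NormedSpace ℝ F]
  (V : M → Type*) [TopologicalSpace (TotalSpace F V)]
  [∀ m, AddCommGroup (V m)] [∀ m, Module ℝ (V m)] [∀ m, TopologicalSpace (V m)]
  [FiberBundle F V]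

/-- The space `Γ(V)` of smooth sections of a vector bundle `V` with typical fibre `F`. -/
abbrev Sec : Type _ := Cₛ^∞⟮𝓘(ℝ, EM); F, V⟯

variable {EM F V}
variable [VectorBundle ℝ F V]

/-- Multiplication of a smooth section by a smooth function. -/
instance : SMul (SmoothFun EM M) (Sec EM F V) :=
  ⟨fun f s => ⟨fun m => f m • s m, f.contMDiff.smul_section s.contMDiff⟩⟩

theorem smul_apply (f : SmoothFun EM M) (s : Sec EM F V) (m : M) : (f • s) m = f m • s m := rfl

variable (F V)

/-- A hom-bundle `(V, φ, β)`: a `φ^*`-function linear map `β : Γ(V) → Γ(V)`. -/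
structure HomBundle (φ : C^∞⟮𝓘(ℝ, EM), M; 𝓘(ℝ, EM), M⟯) where
  toLin : Sec EM F V →ₗ[ℝ] Sec EM F V
  map_fun_smul : ∀ (f : SmoothFun EM M) (s : Sec EM F V),
    toLin (f • s) = pullback φ f • toLin s

/-- A bundle map `φ^! V → φ^! TM`: linear maps `V_{φ(m)} → T_{φ(m)} M` depending smoothly on `m`,
that is, a smooth section along `φ` of the bundle `Hom(V, TM)`. -/
structure AnchorMap [IsManifold 𝓘(ℝ, EM) ∞ M] (φ : C^∞⟮𝓘(ℝ, EM), M; 𝓘(ℝ, EM), M⟯) where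
  toFun : ∀ m : M, V (φ m) →L[ℝ] TangentSpace 𝓘(ℝ, EM) (φ m)
  smooth : ContMDiff 𝓘(ℝ, EM) (𝓘(ℝ, EM).prod 𝓘(ℝ, F →L[ℝ] EM)) ∞ (fun m : M =>
      TotalSpace.mk' (F →L[ℝ] EM) (E := fun p : M => V p →L[ℝ] TangentSpace 𝓘(ℝ, EM) p)
        (φ m) (toFun m))

variable {F V}
variable [IsManifold 𝓘(ℝ, EM) ∞ M] {φ : C^∞⟮𝓘(ℝ, EM), M; 𝓘(ℝ, EM), M⟯}

/-- `ρ(X)[f](m) = ⟨d_{φ(m)} f, ρ_m (X_{φ(m)})⟩`; only the germ of `f` at `φ(m)` matters. -/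
def AnchorMap.deriv (ρ : AnchorMap F V φ) (X : Sec EM F V) (f : M → ℝ) (m : M) : ℝ :=
  mfderiv 𝓘(ℝ, EM) 𝓘(ℝ, ℝ) f (φ m) (ρ.toFun m (X (φ m)))

theorem AnchorMap.deriv_contMDiff (ρ : AnchorMap F V φ) (X : Sec EM F V) (f : SmoothFun EM M) :
    ContMDiff 𝓘(ℝ, EM) 𝓘(ℝ, ℝ) ∞ (ρ.deriv X f) := by
  have hX : ContMDiff 𝓘(ℝ, EM) (𝓘(ℝ, EM).prod 𝓘(ℝ, F)) ∞
      (fun m : M => TotalSpace.mk' F (φ m) (X (φ m))) := X.contMDiff.comp φ.contMDiff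
  have h1 := ρ.smooth.clm_bundle_apply hX
  have h2 : ContMDiff 𝓘(ℝ, EM).tangent 𝓘(ℝ, ℝ).tangent ∞
      (tangentMap 𝓘(ℝ, EM) 𝓘(ℝ, ℝ) f) :=
    f.contMDiff.contMDiff_tangentMap (by simp)
  have h3 := h2.comp h1
  intro m
  have h4 := (contMDiffAt_totalSpace.1 (h3 m)).2
  refine h4.congr_of_eventuallyEq (Filter.Eventually.of_forall fun p => ?_)
  simp only [AnchorMap.deriv, tangentMap, Function.comp_apply, trivializationAt_model_space_apply]
  rfl

/-- The action of `Γ(V)` on `C^∞(M)` through the anchor, `(X, f) ↦ ρ(X)[f]`. -/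
def AnchorMap.action (ρ : AnchorMap F V φ) :
    Sec EM F V →ₗ[ℝ] SmoothFun EM M →ₗ[ℝ] SmoothFun EM M :=
  LinearMap.mk₂ ℝ (fun X f => ⟨ρ.deriv X f, ρ.deriv_contMDiff X f⟩)
    (fun X Y f => by
      ext m
      change ρ.deriv (X + Y) f m = ρ.deriv X f m + ρ.deriv Y f m
      simp only [AnchorMap.deriv, ContMDiffSection.coe_add, Pi.add_apply, map_add]
      rfl)
    (fun c X f => by
      ext m
      change ρ.deriv (c • X) f m = c • ρ.deriv X f m
      simp only [AnchorMap.deriv, ContMDiffSection.coe_smul, Pi.smul_apply, map_smul]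
      rfl)
    (fun X f g => by
      ext m
      change ρ.deriv X (f + g : SmoothFun EM M) m = ρ.deriv X f m + ρ.deriv X g m
      have hf := f.contMDiff.mdifferentiableAt (x := φ m) (by simp)
      have hg := g.contMDiff.mdifferentiableAt (x := φ m) (by simp)
      simp only [AnchorMap.deriv, ContMDiffMap.coe_add]
      rw [mfderiv_add hf hg]
      rfl)
    (fun c X f => by
      ext m
      change ρ.deriv X (c • f : SmoothFun EM M) m = c • ρ.deriv X f m
      have hf := f.contMDiff.mdifferentiableAt (x := φ m) (by simp)
      simp only [AnchorMap.deriv, ContMDiffMap.coe_smul]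
      rw [const_smul_mfderiv hf]
      rfl)

end OneBundle

section Algebroid

variable (FA : Type*) [NormedAddCommGroup FA] [NormedSpace ℝ FA]
  (A : M → Type*) [TopologicalSpace (TotalSpace FA A)]
  [∀ m, AddCommGroup (A m)] [∀ m, Module ℝ (A m)] [∀ m, TopologicalSpace (A m)]
  [FiberBundle FA A] [VectorBundle ℝ FA A]
  [IsManifold 𝓘(ℝ, EM) ∞ M]

/-- A hom-Lie algebroid `(A, φ, [-,-], ρ, α)`. -/
structure HomLieAlgebroid (φ : C^∞⟮𝓘(ℝ, EM), M; 𝓘(ℝ, EM), M⟯) where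
  bracket : Sec EM FA A →ₗ[ℝ] Sec EM FA A →ₗ[ℝ] Sec EM FA A
  anchor : AnchorMap FA A φ
  α : HomBundle FA A φ
  isHomLie : IsHomLieAlgebra bracket α.toLin
  leibniz : ∀ (X : Sec EM FA A) (f : SmoothFun EM M) (Y : Sec EM FA A),
    bracket X (f • Y) = pullback φ f • bracket X Y + anchor.action X f • α.toLin Y
  anchor_rep : IsHomLieRep bracket α.toLin anchor.action (pullback φ)

variable {FA A} {φ : C^∞⟮𝓘(ℝ, EM), M; 𝓘(ℝ, EM), M⟯}
variable {F : Type*} [NormedAddCommGroup F] [NormedSpace ℝ F]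
  {V : M → Type*} [TopologicalSpace (TotalSpace F V)]
  [∀ m, AddCommGroup (V m)] [∀ m, Module ℝ (V m)] [∀ m, TopologicalSpace (V m)]
  [FiberBundle F V] [VectorBundle ℝ F V]

/-- `∇` is a representation of the hom-Lie algebroid `𝒜` on the hom-bundle `(V, φ, β)`. -/
structure IsRepresentation (𝒜 : HomLieAlgebroid FA A φ) (β : HomBundle F V φ)
    (D : Sec EM FA A →ₗ[ℝ] Sec EM F V →ₗ[ℝ] Sec EM F V) : Prop where
  fun_smul_left : ∀ (f : SmoothFun EM M) (x : Sec EM FA A) (s : Sec EM F V),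
    D (f • x) s = pullback φ f • D x s
  leibniz : ∀ (x : Sec EM FA A) (f : SmoothFun EM M) (s : Sec EM F V),
    D x (f • s) = pullback φ f • D x s + 𝒜.anchor.action x f • β.toLin s
  homLieRep : IsHomLieRep 𝒜.bracket 𝒜.α.toLin D β.toLin

end Algebroid

end Bundles

/-! ### The square `E ⊗ E` of a line bundle -/

section TensorSquare

variable {M : Type*}

/-- The fibre of `E ⊗ E`. -/
def Square (E : M → Type*) [∀ m, AddCommGroup (E m)] [∀ m, Module ℝ (E m)] (m : M) : Type _ :=
  E m ⊗[ℝ] E m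

section Fibre

variable (E : M → Type*) [∀ m, AddCommGroup (E m)] [∀ m, Module ℝ (E m)]

instance (m : M) : AddCommGroup (Square E m) := inferInstanceAs (AddCommGroup (E m ⊗[ℝ] E m))
instance (m : M) : Module ℝ (Square E m) := inferInstanceAs (Module ℝ (E m ⊗[ℝ] E m))
/-- The finite-dimensional space `E_m ⊗ E_m` carries its canonical topology. -/
instance (m : M) : TopologicalSpace (Square E m) := moduleTopology ℝ (Square E m)
instance (m : M) : IsModuleTopology ℝ (Square E m) := ⟨rfl⟩

end Fibre

variable {E : M → Type*} [∀ m, AddCommGroup (E m)] [∀ m, Module ℝ (E m)]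

/-- `v ⊗ w` as an element of the fibre of `E ⊗ E`. -/
def Square.tmul {m : M} (v w : E m) : Square E m := v ⊗ₜ[ℝ] w

theorem Square.induction {m : M} {P : Square E m → Prop} (τ : Square E m)
    (h0 : P 0) (h1 : ∀ v w, P (Square.tmul v w)) (h2 : ∀ a b, P a → P b → P (a + b)) : P τ :=
  TensorProduct.induction_on (motive := P) τ h0 h1 h2

theorem Square.smul_tmul_smul {m : M} (a b : ℝ) (v w : E m) :
    Square.tmul (a • v) (b • w) = (a * b) • Square.tmul v w :=
  TensorProduct.smul_tmul_smul a b v w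

/-- `v ⊗ w ↦ l(v) l(w)`. -/
def Square.coord {m : M} (l : E m →ₗ[ℝ] ℝ) : Square E m →ₗ[ℝ] ℝ :=
  LinearMap.mul' ℝ ℝ ∘ₗ TensorProduct.map l l

theorem Square.coord_tmul {m : M} (l : E m →ₗ[ℝ] ℝ) (v w : E m) :
    Square.coord l (Square.tmul v w) = l v * l w := by
  change LinearMap.mul' ℝ ℝ (TensorProduct.map l l (v ⊗ₜ[ℝ] w)) = _
  simp

/-- `l ⊗ l : E_p ⊗ E_p → E_m ⊗ E_m`. -/
def Square.map {p m : M} (l : E p →ₗ[ℝ] E m) : Square E p →ₗ[ℝ] Square E m :=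
  TensorProduct.map l l

theorem Square.map_tmul {p m : M} (l : E p →ₗ[ℝ] E m) (v w : E p) :
    Square.map l (Square.tmul v w) = Square.tmul (l v) (l w) :=
  TensorProduct.map_tmul l l v w

theorem Square.coord_smul_tmul {m : M} (l : E m →ₗ[ℝ] ℝ) (b : E m)
    (h : ∀ v, l v • b = v) (τ : Square E m) : Square.coord l τ • Square.tmul b b = τ := by
  induction τ using Square.induction with
  | h0 => simp
  | h1 v w => rw [Square.coord_tmul, ← Square.smul_tmul_smul, h, h]
  | h2 a b ha hb => rw [map_add, add_smul, ha, hb]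

variable [TopologicalSpace M] [TopologicalSpace (TotalSpace ℝ E)]

/-- The trivialization of `E ⊗ E` induced by a trivialization `e` of the line bundle `E`:
`v ⊗ w ↦ e(v) e(w)`. -/
def Square.pretrivialization (e : Trivialization ℝ (π ℝ E)) [e.IsLinear ℝ] :
    Pretrivialization ℝ (π ℝ (Square E)) where
  toFun p := ⟨p.1, Square.coord (e.linearMapAt ℝ p.1) p.2⟩
  invFun p := ⟨p.1, p.2 • Square.tmul (e.symmₗ ℝ p.1 1) (e.symmₗ ℝ p.1 1)⟩
  source := TotalSpace.proj ⁻¹' e.baseSet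
  target := e.baseSet ×ˢ univ
  map_source' := fun ⟨_, _⟩ h => ⟨h, mem_univ _⟩
  map_target' := fun ⟨_, _⟩ h => h.1
  left_inv' := fun ⟨m, τ⟩ h => by
    simp only [TotalSpace.mk_inj]
    refine Square.coord_smul_tmul _ _ (fun v => ?_) τ
    rw [← map_smul, smul_eq_mul, mul_one]
    exact e.symmₗ_linearMapAt h v
  right_inv' := fun ⟨m, c⟩ ⟨h, _⟩ => by
    simp only [Prod.mk_right_inj, map_smul, Square.coord_tmul]
    rw [e.linearMapAt_symmₗ h]
    simp
  open_target := e.open_baseSet.prod isOpen_univ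
  baseSet := e.baseSet
  open_baseSet := e.open_baseSet
  source_eq := rfl
  target_eq := rfl
  proj_toFun _ _ := rfl

instance Square.isLinear (e : Trivialization ℝ (π ℝ E)) [e.IsLinear ℝ] :
    (Square.pretrivialization e).IsLinear ℝ where
  linear m _ :=
    { map_add := fun a b => map_add (Square.coord (e.linearMapAt ℝ m)) a b
      map_smul := fun c a => map_smul (Square.coord (e.linearMapAt ℝ m)) c a }

variable [∀ m, TopologicalSpace (E m)] [FiberBundle ℝ E] [VectorBundle ℝ ℝ E]

/-- The transition functions of `E ⊗ E` are the squares of those of `E`. -/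
def Square.coordChange (e e' : Trivialization ℝ (π ℝ E)) [e.IsLinear ℝ] [e'.IsLinear ℝ] (m : M) :
    ℝ →L[ℝ] ℝ :=
  ((e.coordChangeL ℝ e' m : ℝ →L[ℝ] ℝ) 1 * (e.coordChangeL ℝ e' m : ℝ →L[ℝ] ℝ) 1) •
    ContinuousLinearMap.id ℝ ℝ

theorem Square.coordChange_apply (e e' : Trivialization ℝ (π ℝ E)) [e.IsLinear ℝ]
    [e'.IsLinear ℝ] (m : M) (hm : m ∈ e.baseSet ∩ e'.baseSet) (c : ℝ) :
    Square.coordChange e e' m c =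
      (Square.pretrivialization e' ⟨m, (Square.pretrivialization e).symm m c⟩).2 := by
  have h1 : (Square.pretrivialization e).symm m c =
      c • Square.tmul (e.symmₗ ℝ m 1) (e.symmₗ ℝ m 1) := by
    rw [Pretrivialization.symm_apply _ hm.1]
    rfl
  rw [h1]
  change _ = Square.coord (e'.linearMapAt ℝ m) _
  have h2 : (e.coordChangeL ℝ e' m : ℝ →L[ℝ] ℝ) 1 =
      e'.linearMapAt ℝ m (e.symmₗ ℝ m 1) := by
    rw [ContinuousLinearEquiv.coe_coe, e.coordChangeL_apply e' hm,
      e'.linearMapAt_apply, if_pos hm.2, e.symmₗ_apply hm.1]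
  rw [map_smul, Square.coord_tmul, ← h2]
  simp [Square.coordChange, mul_comm]

variable (E)

/-- The trivializations `Square.pretrivialization` make `E ⊗ E` a line bundle. -/
def Square.vectorPrebundle : VectorPrebundle ℝ ℝ (Square E) where
  pretrivializationAtlas :=
    {e | ∃ (e₁ : Trivialization ℝ (π ℝ E)) (_ : MemTrivializationAtlas e₁),
      e = Square.pretrivialization e₁}
  pretrivialization_linear' := by
    rintro _ ⟨e, he, rfl⟩
    infer_instance
  pretrivializationAt m := Square.pretrivialization (trivializationAt ℝ E m)
  mem_base_pretrivializationAt m := mem_baseSet_trivializationAt ℝ E m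
  pretrivialization_mem_atlas m := ⟨trivializationAt ℝ E m, inferInstance, rfl⟩
  exists_coordChange := by
    rintro _ ⟨e, he, rfl⟩ _ ⟨e', he', rfl⟩
    refine ⟨Square.coordChange e e', ?_, Square.coordChange_apply e e'⟩
    have h : ContinuousOn (fun m => (e.coordChangeL ℝ e' m : ℝ →L[ℝ] ℝ) 1)
        (e.baseSet ∩ e'.baseSet) :=
      (continuousOn_coordChange ℝ e e').clm_apply continuousOn_const
    exact (h.mul h).smul continuousOn_const
  totalSpaceMk_isInducing m := by
    have hm := mem_baseSet_trivializationAt ℝ E m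
    let e := trivializationAt ℝ E m
    let L : Square E m ≃ₗ[ℝ] ℝ := (Square.pretrivialization e).linearEquivAt ℝ m hm
    have h1 : Continuous L := IsModuleTopology.continuous_of_linearMap L.toLinearMap
    have : ContinuousAdd (Square E m) := IsModuleTopology.toContinuousAdd ℝ (Square E m)
    have h2 : Continuous L.symm := IsModuleTopology.continuous_of_linearMap L.symm.toLinearMap
    have h3 : IsInducing L :=
      (Homeomorph.mk L.toEquiv h1 h2).isInducing
    exact isInducing_const_prod.mpr h3

instance Square.topologicalSpaceTotalSpace : TopologicalSpace (TotalSpace ℝ (Square E)) :=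
  (Square.vectorPrebundle E).totalSpaceTopology

instance Square.fiberBundle : FiberBundle ℝ (Square E) :=
  (Square.vectorPrebundle E).toFiberBundle

instance Square.vectorBundle : VectorBundle ℝ ℝ (Square E) :=
  (Square.vectorPrebundle E).toVectorBundle

theorem Square.trivializationAt_apply (m p : M) (τ : Square E p) :
    (trivializationAt ℝ (Square E) m ⟨p, τ⟩).2 =
      Square.coord ((trivializationAt ℝ E m).linearMapAt ℝ p) τ := rfl

variable {EM : Type*} [NormedAddCommGroup EM] [NormedSpace ℝ EM] [ChartedSpace EM M]
  [ContMDiffVectorBundle ∞ ℝ E 𝓘(ℝ, EM)]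

instance Square.isContMDiff : (Square.vectorPrebundle E).IsContMDiff 𝓘(ℝ, EM) ∞ where
  exists_contMDiffCoordChange := by
    rintro _ ⟨e, he, rfl⟩ _ ⟨e', he', rfl⟩
    refine ⟨Square.coordChange e e', ?_, Square.coordChange_apply e e'⟩
    have h : ContMDiffOn 𝓘(ℝ, EM) 𝓘(ℝ, ℝ) ∞
        (fun m => (e.coordChangeL ℝ e' m : ℝ →L[ℝ] ℝ) 1) (e.baseSet ∩ e'.baseSet) :=
      (contMDiffOn_coordChangeL e e').clm_apply contMDiffOn_const
    exact (h.mul h).smul contMDiffOn_const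

/-- `E ⊗ E` is a smooth line bundle. -/
instance Square.contMDiffVectorBundle : ContMDiffVectorBundle ∞ ℝ (Square E) 𝓘(ℝ, EM) :=
  (Square.vectorPrebundle E).contMDiffVectorBundle 𝓘(ℝ, EM)

variable {E}

theorem Square.tmul_contMDiff (s t : Sec EM ℝ E) :
    ContMDiff 𝓘(ℝ, EM) (𝓘(ℝ, EM).prod 𝓘(ℝ, ℝ)) ∞
      (fun m => TotalSpace.mk' ℝ (E := Square E) m (Square.tmul (s m) (t m))) := by
  intro m
  rw [contMDiffAt_section]
  have hs := (contMDiffAt_section m).1 (s.contMDiff m)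
  have ht := (contMDiffAt_section m).1 (t.contMDiff m)
  refine (hs.mul ht).congr_of_eventuallyEq ?_
  filter_upwards [(trivializationAt ℝ E m).open_baseSet.mem_nhds
    (mem_baseSet_trivializationAt ℝ E m)] with p hp
  rw [Square.trivializationAt_apply, Square.coord_tmul, Trivialization.linearMapAt_apply,
    Trivialization.linearMapAt_apply, if_pos hp, if_pos hp]
  rfl

/-- The section `s ⊗ t` of `E ⊗ E`. -/
def Square.sec (s t : Sec EM ℝ E) : Sec EM ℝ (Square E) :=
  ⟨fun m => Square.tmul (s m) (t m), Square.tmul_contMDiff s t⟩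

end TensorSquare

/-! ### The square `(E ⊗ E, φ, β ⊗ β)` of a hom-bundle `(E, φ, β)` -/

section SquareHomBundle

variable {EM : Type*} [NormedAddCommGroup EM] [NormedSpace ℝ EM] [FiniteDimensional ℝ EM]
  {M : Type*} [TopologicalSpace M] [T2Space M] [ChartedSpace EM M] [IsManifold 𝓘(ℝ, EM) ∞ M]
  {E : M → Type*} [TopologicalSpace (TotalSpace ℝ E)]
  [∀ m, AddCommGroup (E m)] [∀ m, Module ℝ (E m)] [∀ m, TopologicalSpace (E m)]
  [FiberBundle ℝ E] [VectorBundle ℝ ℝ E] [ContMDiffVectorBundle ∞ ℝ E 𝓘(ℝ, EM)]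

theorem exists_cutoff (p : M) (u : Set M) (hu : u ∈ 𝓝 p) :
    ∃ χ : SmoothFun EM M, χ p = 1 ∧ tsupport χ ⊆ u := by
  obtain ⟨f, -, hf⟩ := (SmoothBumpFunction.nhds_basis_tsupport (I := 𝓘(ℝ, EM)) p).mem_iff.1 hu
  exact ⟨⟨f, f.contMDiff⟩, f.eq_one, hf⟩

/-- Every vector of the bundle is the value of a global smooth section. -/
theorem exists_sec (p : M) (v : E p) : ∃ s : Sec EM ℝ E, s p = v := by
  obtain ⟨u, hu, hs⟩ := FiberBundle.exists_contMDiffOn_extend 𝓘(ℝ, EM) ℝ (k := ∞) v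
  obtain ⟨χ, h1, h2⟩ := exists_cutoff (EM := EM) p (interior u) (interior_mem_nhds.2 hu)
  refine ⟨⟨_, χ.contMDiff.contMDiffOn.smul_section_of_tsupport isOpen_interior h2
    (hs.mono interior_subset)⟩, ?_⟩
  change χ p • FiberBundle.extend ℝ v p = v
  simp [h1]

/-- A section that vanishes at `p` is, near `p`, a section times a function vanishing at `p`. -/
theorem exists_factor (p : M) (s : Sec EM ℝ E) (hs : s p = 0) :
    ∃ (χ c : SmoothFun EM M) (t : Sec EM ℝ E), χ p = 1 ∧ c p = 0 ∧ χ • s = c • t := by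
  set e := trivializationAt ℝ E p with he
  have hp : p ∈ e.baseSet := mem_baseSet_trivializationAt ℝ E p
  obtain ⟨χ, h1, h2⟩ := exists_cutoff (EM := EM) p e.baseSet (e.open_baseSet.mem_nhds hp)
  have hb : ContMDiffOn 𝓘(ℝ, EM) (𝓘(ℝ, EM).prod 𝓘(ℝ, ℝ)) ∞
      (fun q => TotalSpace.mk' ℝ q (e.symmₗ ℝ q 1)) e.baseSet := by
    rw [e.contMDiffOn_section_baseSet_iff]
    refine (contMDiffOn_const (c := (1 : ℝ))).congr fun q hq => ?_
    rw [e.symmₗ_apply hq, e.apply_mk_symm hq]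
  have hc : ContMDiff 𝓘(ℝ, EM) 𝓘(ℝ, ℝ) ∞ (fun q => χ q * e.linearMapAt ℝ q (s q)) := by
    refine contMDiff_of_tsupport fun q hq => ?_
    have hq' : q ∈ e.baseSet := h2 (tsupport_mul_subset_left hq)
    refine (χ.contMDiff q).mul ?_
    refine ((e.contMDiffAt_section_iff hq').1 (s.contMDiff q)).congr_of_eventuallyEq ?_
    filter_upwards [e.open_baseSet.mem_nhds hq'] with r hr
    rw [e.linearMapAt_apply, if_pos hr]
  refine ⟨χ * χ, ⟨_, hc⟩, ⟨_, χ.contMDiff.contMDiffOn.smul_section_of_tsupport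
    e.open_baseSet h2 hb⟩, ?_, ?_, ?_⟩
  · simp [h1]
  · simp [hs]
  · ext q
    change (χ q * χ q) • s q = (χ q * e.linearMapAt ℝ q (s q)) • χ q • e.symmₗ ℝ q 1
    by_cases hq : q ∈ e.baseSet
    · conv_lhs => rw [← e.symmₗ_linearMapAt (R := ℝ) hq (s q)]
      rw [show e.linearMapAt ℝ q (s q) = e.linearMapAt ℝ q (s q) • (1 : ℝ) by simp, map_smul,
        smul_smul, smul_smul]
      congr 1
      simp only [smul_eq_mul]
      ring
    · have : χ q = 0 := by
        by_contra h
        exact hq (h2 (subset_tsupport _ h))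
      simp [this]

variable {φ : C^∞⟮𝓘(ℝ, EM), M; 𝓘(ℝ, EM), M⟯}

theorem HomBundle.apply_eq_zero (β : HomBundle ℝ E φ) (s : Sec EM ℝ E) (m : M)
    (hs : s (φ m) = 0) : β.toLin s m = 0 := by
  obtain ⟨χ, c, t, h1, h2, h3⟩ := exists_factor (φ m) s hs
  have h4 := congrArg (fun σ : Sec EM ℝ E => σ m) (congrArg β.toLin h3)
  simp only [β.map_fun_smul, smul_apply] at h4
  change χ (φ m) • β.toLin s m = c (φ m) • β.toLin t m at h4
  simpa [h1, h2] using h4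

theorem HomBundle.apply_eq (β : HomBundle ℝ E φ) (s t : Sec EM ℝ E) (m : M)
    (h : s (φ m) = t (φ m)) : β.toLin s m = β.toLin t m := by
  have := β.apply_eq_zero (s - t) m (by simp [h])
  rw [map_sub] at this
  exact sub_eq_zero.1 this

/-- The linear map `β_m : E_{φ(m)} → E_m` with `β(s)(m) = β_m(s(φ(m)))`. -/
def HomBundle.fibreMap (β : HomBundle ℝ E φ) (m : M) : E (φ m) →ₗ[ℝ] E m where
  toFun v := β.toLin (exists_sec (φ m) v).choose m
  map_add' v w := by
    have h := β.apply_eq (exists_sec (EM := EM) (φ m) (v + w)).choose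
      ((exists_sec (φ m) v).choose + (exists_sec (φ m) w).choose) m (by
        rw [(exists_sec (φ m) (v + w)).choose_spec, ContMDiffSection.coe_add, Pi.add_apply,
          (exists_sec (φ m) v).choose_spec, (exists_sec (φ m) w).choose_spec])
    rw [h, map_add]
    rfl
  map_smul' c v := by
    have h := β.apply_eq (exists_sec (EM := EM) (φ m) (c • v)).choose
      (c • (exists_sec (φ m) v).choose) m (by
        rw [(exists_sec (φ m) (c • v)).choose_spec, ContMDiffSection.coe_smul, Pi.smul_apply,
          (exists_sec (φ m) v).choose_spec])
    rw [h, map_smul]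
    rfl

theorem HomBundle.fibreMap_apply (β : HomBundle ℝ E φ) (s : Sec EM ℝ E) (m : M) :
    β.fibreMap m (s (φ m)) = β.toLin s m :=
  β.apply_eq _ s m (exists_sec (φ m) (s (φ m))).choose_spec

theorem HomBundle.square_contMDiff (β : HomBundle ℝ E φ) (σ : Sec EM ℝ (Square E)) :
    ContMDiff 𝓘(ℝ, EM) (𝓘(ℝ, EM).prod 𝓘(ℝ, ℝ)) ∞
      (fun m => TotalSpace.mk' ℝ (E := Square E) m (Square.map (β.fibreMap m) (σ (φ m)))) := by
  intro m₀
  set p := φ m₀ with hpdef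
  set e := trivializationAt ℝ E p with he
  have hp : p ∈ e.baseSet := mem_baseSet_trivializationAt ℝ E p
  obtain ⟨t, ht⟩ := exists_sec (EM := EM) p (e.symmₗ ℝ p 1)
  let g : M → ℝ := fun q => (e ⟨q, t q⟩).2
  let c : M → ℝ := fun q => (trivializationAt ℝ (Square E) p ⟨q, σ q⟩).2 / (g q * g q)
  have hg : ContMDiffAt 𝓘(ℝ, EM) 𝓘(ℝ, ℝ) ∞ g p := (contMDiffAt_section p).1 (t.contMDiff p)
  have hgp : g p = 1 := by
    simp only [g]
    rw [ht, e.symmₗ_apply hp, e.apply_mk_symm hp]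
  have hc : ContMDiffAt 𝓘(ℝ, EM) 𝓘(ℝ, ℝ) ∞ c p :=
    ((contMDiffAt_section p).1 (σ.contMDiff p)).div₀ (hg.mul hg) (by simp [hgp])
  have hσ : ∀ᶠ q in 𝓝 p, σ q = c q • Square.tmul (t q) (t q) := by
    filter_upwards [e.open_baseSet.mem_nhds hp,
      hg.continuousAt.eventually_ne (by rw [hgp]; exact one_ne_zero)] with q hq hgq
    have hb : ∀ v : E q, e.linearMapAt ℝ q v • e.symmₗ ℝ q 1 = v := fun v => by
      rw [← map_smul, smul_eq_mul, mul_one, e.symmₗ_linearMapAt hq]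
    have hgq' : g q = e.linearMapAt ℝ q (t q) := by
      rw [e.linearMapAt_apply, if_pos hq]
    have h1 := Square.coord_smul_tmul _ _ hb (σ q)
    have h2 : Square.tmul (t q) (t q) =
        (g q * g q) • Square.tmul (e.symmₗ ℝ q 1) (e.symmₗ ℝ q 1) := by
      rw [← Square.smul_tmul_smul, hgq', hb]
    rw [h2, smul_smul]
    simp only [c]
    rw [div_mul_cancel₀ _ (mul_ne_zero hgq hgq), Square.trivializationAt_apply]
    exact h1.symm
  have hcφ : ContMDiffAt 𝓘(ℝ, EM) 𝓘(ℝ, ℝ) ∞ (fun m => c (φ m)) m₀ :=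
    ContMDiffAt.comp m₀ hc (φ.contMDiff m₀)
  have key := hcφ.smul_section ((Square.sec (β.toLin t) (β.toLin t)).contMDiff m₀)
  refine key.congr_of_eventuallyEq ?_
  filter_upwards [φ.contMDiff.continuous.continuousAt.eventually hσ] with m hm
  simp only [TotalSpace.mk_inj]
  rw [hm, map_smul, Square.map_tmul, β.fibreMap_apply]
  rfl

/-- The square hom-bundle `(E ⊗ E, φ, β ⊗ β)`. -/
def HomBundle.square (β : HomBundle ℝ E φ) : HomBundle ℝ (Square E) φ where
  toLin :=
    { toFun := fun σ => ⟨fun m => Square.map (β.fibreMap m) (σ (φ m)), β.square_contMDiff σ⟩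
      map_add' := fun σ τ => by
        ext m
        exact map_add (Square.map (β.fibreMap m)) (σ (φ m)) (τ (φ m))
      map_smul' := fun c σ => by
        ext m
        exact map_smul (Square.map (β.fibreMap m)) c (σ (φ m)) }
  map_fun_smul f σ := by
    ext m
    exact map_smul (Square.map (β.fibreMap m)) (f (φ m)) (σ (φ m))

/-- `(β ⊗ β)(s ⊗ t) = β(s) ⊗ β(t)`. -/
theorem HomBundle.square_sec (β : HomBundle ℝ E φ) (s t : Sec EM ℝ E) :
    β.square.toLin (Square.sec s t) = Square.sec (β.toLin s) (β.toLin t) := by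
  ext m
  change Square.map (β.fibreMap m) (Square.tmul (s (φ m)) (t (φ m))) = _
  rw [Square.map_tmul, β.fibreMap_apply, β.fibreMap_apply]
  rfl

end SquareHomBundle

/-! ### The local formula -/

section SquareRoot

/-- The quotient `a / b` of two vectors of a line, `b ≠ 0`: the number `c` with `a = c • b`. -/
def lineQuot {L : Type*} [AddCommGroup L] [Module ℝ L] (a b : L) : ℝ :=
  open Classical in if h : ∃ c : ℝ, a = c • b then h.choose else 0

theorem lineQuot_smul {L : Type*} [AddCommGroup L] [Module ℝ L] (c : ℝ) (b : L) (hb : b ≠ 0) :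
    lineQuot (c • b) b = c := by
  have h : ∃ c' : ℝ, c • b = c' • b := ⟨c, rfl⟩
  rw [lineQuot, dif_pos h]
  exact (smul_left_injective ℝ hb h.choose_spec).symm

variable {EM : Type*} [NormedAddCommGroup EM] [NormedSpace ℝ EM] [FiniteDimensional ℝ EM]
  {M : Type*} [TopologicalSpace M] [T2Space M] [ChartedSpace EM M] [IsManifold 𝓘(ℝ, EM) ∞ M]
  {FA : Type*} [NormedAddCommGroup FA] [NormedSpace ℝ FA]
  {A : M → Type*} [TopologicalSpace (TotalSpace FA A)]
  [∀ m, AddCommGroup (A m)] [∀ m, Module ℝ (A m)] [∀ m, TopologicalSpace (A m)]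
  [FiberBundle FA A] [VectorBundle ℝ FA A]
  {E : M → Type*} [TopologicalSpace (TotalSpace ℝ E)]
  [∀ m, AddCommGroup (E m)] [∀ m, Module ℝ (E m)] [∀ m, TopologicalSpace (E m)]
  [FiberBundle ℝ E] [VectorBundle ℝ ℝ E] [ContMDiffVectorBundle ∞ ℝ E 𝓘(ℝ, EM)]
  {φ : C^∞⟮𝓘(ℝ, EM), M; 𝓘(ℝ, EM), M⟯}

/-- `D` is given by the local formulas: whenever `s = f t` on an open set `U`, with `f ∈ C^∞(U)`
and `t` a section of `E` vanishing nowhere on `U`, then on `φ⁻¹(U)`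
`D(x, s) = ρ(x)[f] β(t) + (1/2) (Dbar(x, t ⊗ t) / (β ⊗ β)(t ⊗ t)) β(s)`. -/
def IsSqrtOf (𝒜 : HomLieAlgebroid FA A φ) (β : HomBundle ℝ E φ)
    (Dbar : Sec EM FA A →ₗ[ℝ] Sec EM ℝ (Square E) →ₗ[ℝ] Sec EM ℝ (Square E))
    (D : Sec EM FA A → Sec EM ℝ E → Sec EM ℝ E) : Prop :=
  ∀ (x : Sec EM FA A) (s : Sec EM ℝ E) (U : Set M) (f : M → ℝ) (t : Sec EM ℝ E),
    IsOpen U → ContMDiffOn 𝓘(ℝ, EM) 𝓘(ℝ, ℝ) ∞ f U →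
    (∀ p ∈ U, t p ≠ 0) → (∀ p ∈ U, s p = f p • t p) →
    ∀ m : M, φ m ∈ U →
      D x s m = 𝒜.anchor.deriv x f m • β.toLin t m +
        ((1 / 2 : ℝ) * lineQuot (Dbar x (Square.sec t t) m)
          (β.square.toLin (Square.sec t t) m)) • β.toLin s m

end SquareRoot

end HomAlgebroid

end

open HomAlgebroid

namespace HomAlgebroid

/-! Near `φ m` every section `s` is `f t` with `t` nonvanishing, so the local formula prescribes the
value of the root at `m`; uniqueness is immediate, and existence means independence of `f` and `t`.
Write `Q(t)` for the quotient of `Dbar x (t ⊗ t)` by `β.square (t ⊗ t)`, evaluated at `m`. If `t' =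
g t` near `φ m`, the Leibniz rule applied to `t' ⊗ t' = g² (t ⊗ t)` gives `Q(t') = Q(t) + 2 ρ(x)[g]
/ g(φ m)`. Half of this correction is exactly what the term `ρ(x)[f] β(t)` loses when `f = f' g` is
replaced by `f'` (`sqrtValue_eq_sqrtValue`). Freedom in `t` and `f` then gives smoothness,
bilinearity, both function rules and the tensor-square identity (`sqrtRep_square`) by short
computations.

The hom-Lie axioms need no local computation. The defect `Δ` of either axiom satisfies `Δ(s) ⊗ β²(t)
+ β²(s) ⊗ Δ(t) = 0`, because `Dbar` obeys the same axiom on `s ⊗ t`. On a line bundle with `β`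
fibrewise invertible this forces `Δ = 0` (`eq_zero_of_square_eq_zero`). Equivariance comes first,
since it makes the mixed terms cancel in the bracket axiom. -/

theorem lineQuot_smul_self {L : Type*} [AddCommGroup L] [Module ℝ L] (a b : L)
    (h : ∃ c : ℝ, a = c • b) : lineQuot a b • b = a := by
  rw [lineQuot, dif_pos h]
  exact h.choose_spec.symm

/-! ### Quotients of sections of a line bundle -/

section Germs

variable {EM : Type*} [NormedAddCommGroup EM] [NormedSpace ℝ EM]
  {M : Type*} [TopologicalSpace M] [ChartedSpace EM M]
  {V : M → Type*} [TopologicalSpace (TotalSpace ℝ V)]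
  [∀ m, AddCommGroup (V m)] [∀ m, Module ℝ (V m)] [∀ m, TopologicalSpace (V m)]
  [FiberBundle ℝ V] [VectorBundle ℝ ℝ V]

/-- In a local trivialization, the quotient of two vectors of a line bundle is the quotient of
their coordinates. -/
theorem eq_coord_div_smul (e : Trivialization ℝ (π ℝ V)) [e.IsLinear ℝ] {m : M}
    (hm : m ∈ e.baseSet) (v w : V m) (hw : w ≠ 0) :
    (e ⟨m, w⟩).2 ≠ 0 ∧ v = ((e ⟨m, v⟩).2 / (e ⟨m, w⟩).2) • w := by
  have key : ∀ u : V m, (e ⟨m, u⟩).2 = e.linearEquivAt ℝ m hm u := fun u => rfl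
  rw [key, key]
  have h0 : e.linearEquivAt ℝ m hm w ≠ 0 :=
    (e.linearEquivAt ℝ m hm).map_ne_zero_iff.2 hw
  refine ⟨h0, (e.linearEquivAt ℝ m hm).injective ?_⟩
  rw [map_smul, smul_eq_mul, div_mul_cancel₀ _ h0]

theorem lineQuot_smul_of_ne_zero {m : M} (v w : V m) (hw : w ≠ 0) : lineQuot v w • w = v :=
  lineQuot_smul_self _ _
    ⟨_, (eq_coord_div_smul _ (mem_baseSet_trivializationAt ℝ V m) v w hw).2⟩

theorem eventually_ne_zero (t : Sec EM ℝ V) (p : M) (ht : t p ≠ 0) : ∀ᶠ q in 𝓝 p, t q ≠ 0 := by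
  set e := trivializationAt ℝ V p
  have hp : p ∈ e.baseSet := mem_baseSet_trivializationAt ℝ V p
  have hc : ContMDiffAt 𝓘(ℝ, EM) 𝓘(ℝ, ℝ) ∞ (fun q => (e ⟨q, t q⟩).2) p :=
    (contMDiffAt_section p).1 (t.contMDiff p)
  -- The argument `0` is a dummy: only the nonvanishing of the coordinate of `t p` is used.
  filter_upwards [e.open_baseSet.mem_nhds hp,
    hc.continuousAt.eventually_ne (eq_coord_div_smul e hp 0 (t p) ht).1] with q hq h h0
  apply h
  rw [h0]
  exact map_zero (e.linearEquivAt ℝ q hq)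

/-- Near `p` the quotient is a ratio of smooth coordinates in one trivialization; where `t` vanishes
`lineQuot` may take its default value, but such points stay away from `p`. -/
theorem contMDiffAt_lineQuot (s t : Sec EM ℝ V) (p : M) (ht : t p ≠ 0) :
    ContMDiffAt 𝓘(ℝ, EM) 𝓘(ℝ, ℝ) ∞ (fun q => lineQuot (s q) (t q)) p := by
  set e := trivializationAt ℝ V p
  have hp : p ∈ e.baseSet := mem_baseSet_trivializationAt ℝ V p
  have hs : ContMDiffAt 𝓘(ℝ, EM) 𝓘(ℝ, ℝ) ∞ (fun q => (e ⟨q, s q⟩).2) p :=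
    (contMDiffAt_section p).1 (s.contMDiff p)
  have hc : ContMDiffAt 𝓘(ℝ, EM) 𝓘(ℝ, ℝ) ∞ (fun q => (e ⟨q, t q⟩).2) p :=
    (contMDiffAt_section p).1 (t.contMDiff p)
  refine (hs.div₀ hc (eq_coord_div_smul e hp 0 (t p) ht).1).congr_of_eventuallyEq ?_
  filter_upwards [e.open_baseSet.mem_nhds hp, eventually_ne_zero t p ht] with q hq hq0
  refine smul_left_injective ℝ hq0 ?_
  change _ • _ = _ • _
  rw [lineQuot_smul_of_ne_zero _ _ hq0]
  exact (eq_coord_div_smul e hq (s q) (t q) hq0).2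

/-! ### Cutoffs and dependence on germs -/

variable [FiniteDimensional ℝ EM] [T2Space M] [IsManifold 𝓘(ℝ, EM) ∞ M]

/-- Every germ of a smooth function is the germ of a global smooth function. -/
theorem exists_smoothFun_eventuallyEq (f : M → ℝ) (U : Set M) (hU : IsOpen U)
    (hf : ContMDiffOn 𝓘(ℝ, EM) 𝓘(ℝ, ℝ) ∞ f U) (p : M) (hp : p ∈ U) :
    ∃ g : SmoothFun EM M, f =ᶠ[𝓝 p] g := by
  obtain ⟨χ, -, hχ⟩ :=
    (SmoothBumpFunction.nhds_basis_tsupport (I := 𝓘(ℝ, EM)) p).mem_iff.1 (hU.mem_nhds hp)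
  refine ⟨⟨fun q => χ q * f q, contMDiff_of_tsupport fun q hq => ?_⟩, ?_⟩
  · exact (χ.contMDiff q).mul (hf.contMDiffAt (hU.mem_nhds (hχ (tsupport_mul_subset_left hq))))
  · filter_upwards [χ.eventuallyEq_one] with q hq
    change f q = χ q * f q
    rw [hq]
    simp

/-- Near a point where `t` does not vanish, every section is a smooth multiple of `t`. -/
theorem exists_eventuallyEq_smul (s t : Sec EM ℝ V) (p : M) (ht : t p ≠ 0) :
    ∃ f : SmoothFun EM M, ∀ᶠ q in 𝓝 p, s q = f q • t q := by
  obtain ⟨U, hU, hUo, hpU⟩ := eventually_nhds_iff.1 (eventually_ne_zero t p ht)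
  obtain ⟨f, hf⟩ := exists_smoothFun_eventuallyEq (fun q => lineQuot (s q) (t q)) U hUo
    (fun q hq => (contMDiffAt_lineQuot s t q (hU q hq)).contMDiffWithinAt) p hpU
  refine ⟨f, ?_⟩
  filter_upwards [hf, eventually_ne_zero t p ht] with q hq hq0
  rw [← hq, lineQuot_smul_of_ne_zero _ _ hq0]

/-- A cutoff supported where `σ` and `τ` agree turns equality of germs into equality of global
sections, to which semilinearity or a Leibniz rule applies. -/
theorem exists_cutoff_smul_eq (σ τ : Sec EM ℝ V) (p : M) (h : ∀ᶠ q in 𝓝 p, σ q = τ q) :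
    ∃ χ : SmoothFun EM M, χ p = 1 ∧ χ • σ = χ • τ := by
  obtain ⟨χ, h1, h2⟩ := exists_cutoff (EM := EM) p _ h
  refine ⟨χ, h1, ?_⟩
  ext q
  rw [smul_apply, smul_apply]
  by_cases hq : χ q = 0
  · rw [hq, zero_smul, zero_smul]
  · rw [h2 (subset_tsupport _ hq)]

variable {φ : C^∞⟮𝓘(ℝ, EM), M; 𝓘(ℝ, EM), M⟯}

theorem HomBundle.toLin_smul_apply (β : HomBundle ℝ V φ) (f : SmoothFun EM M) (s : Sec EM ℝ V)
    (m : M) : β.toLin (f • s) m = f (φ m) • β.toLin s m := by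
  rw [β.map_fun_smul]
  rfl

theorem HomBundle.congr_of_eventuallyEq (β : HomBundle ℝ V φ) (σ τ : Sec EM ℝ V) (m : M)
    (h : ∀ᶠ q in 𝓝 (φ m), σ q = τ q) : β.toLin σ m = β.toLin τ m := by
  obtain ⟨χ, h1, h2⟩ := exists_cutoff_smul_eq σ τ (φ m) h
  have h3 := congrArg (fun s : Sec EM ℝ V => β.toLin s m) h2
  simpa only [β.toLin_smul_apply, h1, one_smul] using h3

theorem HomBundle.apply_of_eventuallyEq_smul (β : HomBundle ℝ V φ) (f : SmoothFun EM M)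
    (σ τ : Sec EM ℝ V) (m : M) (h : ∀ᶠ q in 𝓝 (φ m), σ q = f q • τ q) :
    β.toLin σ m = f (φ m) • β.toLin τ m := by
  rw [β.congr_of_eventuallyEq σ (f • τ) m h, β.toLin_smul_apply]

variable {FA : Type*} [NormedAddCommGroup FA] [NormedSpace ℝ FA]
  {A : M → Type*} [TopologicalSpace (TotalSpace FA A)]
  [∀ m, AddCommGroup (A m)] [∀ m, Module ℝ (A m)] [∀ m, TopologicalSpace (A m)]
  [FiberBundle FA A] [VectorBundle ℝ FA A]

theorem AnchorMap.deriv_congr (ρ : AnchorMap FA A φ) (x : Sec EM FA A) {f g : M → ℝ} {m : M}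
    (h : f =ᶠ[𝓝 (φ m)] g) : ρ.deriv x f m = ρ.deriv x g m := by
  rw [AnchorMap.deriv, AnchorMap.deriv]
  rw [h.mfderiv_eq]
  rfl

theorem AnchorMap.deriv_mul (ρ : AnchorMap FA A φ) (x : Sec EM FA A) (f g : SmoothFun EM M)
    (m : M) : ρ.deriv x (f * g : SmoothFun EM M) m =
      f (φ m) * ρ.deriv x g m + g (φ m) * ρ.deriv x f m := by
  have hf := (f.contMDiff.mdifferentiableAt (x := φ m) (by simp)).hasMFDerivAt
  have hg := (g.contMDiff.mdifferentiableAt (x := φ m) (by simp)).hasMFDerivAt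
  have h := (hf.mul hg).mfderiv
  change mfderiv 𝓘(ℝ, EM) 𝓘(ℝ, ℝ) (⇑f * ⇑g) (φ m) (ρ.toFun m (x (φ m))) = _
  rw [h]
  rfl

theorem AnchorMap.deriv_smul_left (ρ : AnchorMap FA A φ) (f : SmoothFun EM M) (x : Sec EM FA A)
    (g : M → ℝ) (m : M) : ρ.deriv (f • x) g m = f (φ m) * ρ.deriv x g m := by
  simp only [AnchorMap.deriv, smul_apply, map_smul]
  rfl

theorem IsRepresentation.leibniz_apply {𝒜 : HomLieAlgebroid FA A φ} {β : HomBundle ℝ V φ}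
    {D : Sec EM FA A →ₗ[ℝ] Sec EM ℝ V →ₗ[ℝ] Sec EM ℝ V} (hD : IsRepresentation 𝒜 β D)
    (x : Sec EM FA A) (f : SmoothFun EM M) (s : Sec EM ℝ V) (m : M) :
    D x (f • s) m = f (φ m) • D x s m + 𝒜.anchor.deriv x f m • β.toLin s m := by
  rw [hD.leibniz]
  rfl

/-- The Leibniz rule makes `D x σ m` depend only on the germ of `σ` at `φ m`, so it may be used with
local factorizations. -/
theorem IsRepresentation.apply_of_eventuallyEq_smul {𝒜 : HomLieAlgebroid FA A φ}
    {β : HomBundle ℝ V φ} {D : Sec EM FA A →ₗ[ℝ] Sec EM ℝ V →ₗ[ℝ] Sec EM ℝ V}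
    (hD : IsRepresentation 𝒜 β D) (x : Sec EM FA A) (f : SmoothFun EM M) (σ τ : Sec EM ℝ V)
    (m : M) (h : ∀ᶠ q in 𝓝 (φ m), σ q = f q • τ q) :
    D x σ m = f (φ m) • D x τ m + 𝒜.anchor.deriv x f m • β.toLin τ m := by
  rw [← hD.leibniz_apply]
  obtain ⟨χ, h1, h2⟩ := exists_cutoff_smul_eq σ (f • τ) (φ m) h
  have h3 := congrArg (fun s : Sec EM ℝ V => D x s m) h2
  simp only [hD.leibniz_apply x χ, h1, one_smul] at h3
  -- The derivative of the cutoff need not be computed: it multiplies `β` of two sections with the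
  -- same germ, so both sides carry the same extra term.
  rw [β.congr_of_eventuallyEq σ (f • τ) m h] at h3
  exact add_right_cancel h3

end Germs

/-! ### Algebra in the fibres of the tensor square -/

section SquareRootRepresentation

section SquareFibre

variable {M : Type*} {E : M → Type*} [∀ m, AddCommGroup (E m)] [∀ m, Module ℝ (E m)]

theorem Square.sub_tmul {m : M} (u v w : E m) :
    Square.tmul (u - v) w = Square.tmul u w - Square.tmul v w := TensorProduct.sub_tmul u v w

theorem Square.tmul_sub {m : M} (u v w : E m) :
    Square.tmul u (v - w) = Square.tmul u v - Square.tmul u w := TensorProduct.tmul_sub u v w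

theorem Square.smul_tmul {m : M} (a : ℝ) (v w : E m) :
    Square.tmul (a • v) w = a • Square.tmul v w := TensorProduct.smul_tmul' a v w

theorem Square.tmul_smul {m : M} (a : ℝ) (v w : E m) :
    Square.tmul v (a • w) = a • Square.tmul v w := TensorProduct.tmul_smul a v w

theorem Square.tmul_zero {m : M} (w : E m) : Square.tmul w 0 = 0 := TensorProduct.tmul_zero _ w

variable [TopologicalSpace M] [TopologicalSpace (TotalSpace ℝ E)]
  [∀ m, TopologicalSpace (E m)] [FiberBundle ℝ E] [VectorBundle ℝ ℝ E]

/-- A linear coordinate `L` on the line induces a functional on its square sending `v ⊗ w` to `L v *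
L w`, a product of nonzero reals. -/
theorem Square.tmul_ne_zero {m : M} {v w : E m} (hv : v ≠ 0) (hw : w ≠ 0) :
    Square.tmul v w ≠ 0 := by
  let L := (trivializationAt ℝ E m).linearEquivAt ℝ m (mem_baseSet_trivializationAt ℝ E m)
  intro h
  have h1 := Square.coord_tmul (L : E m →ₗ[ℝ] ℝ) v w
  rw [h, map_zero] at h1
  exact mul_ne_zero (L.map_ne_zero_iff.2 hv) (L.map_ne_zero_iff.2 hw) h1.symm

end SquareFibre

variable {EM : Type*} [NormedAddCommGroup EM] [NormedSpace ℝ EM] [FiniteDimensional ℝ EM]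
  {M : Type*} [TopologicalSpace M] [T2Space M] [ChartedSpace EM M] [IsManifold 𝓘(ℝ, EM) ∞ M]
  {FA : Type*} [NormedAddCommGroup FA] [NormedSpace ℝ FA]
  {A : M → Type*} [TopologicalSpace (TotalSpace FA A)]
  [∀ m, AddCommGroup (A m)] [∀ m, Module ℝ (A m)] [∀ m, TopologicalSpace (A m)]
  [FiberBundle FA A] [VectorBundle ℝ FA A]
  {E : M → Type*} [TopologicalSpace (TotalSpace ℝ E)]
  [∀ m, AddCommGroup (E m)] [∀ m, Module ℝ (E m)] [∀ m, TopologicalSpace (E m)]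
  [FiberBundle ℝ E] [VectorBundle ℝ ℝ E] [ContMDiffVectorBundle ∞ ℝ E 𝓘(ℝ, EM)]
  {φ : C^∞⟮𝓘(ℝ, EM), M; 𝓘(ℝ, EM), M⟯}

theorem exists_sec_ne_zero (p : M) : ∃ t : Sec EM ℝ E, t p ≠ 0 := by
  let L := (trivializationAt ℝ E p).linearEquivAt ℝ p (mem_baseSet_trivializationAt ℝ E p)
  obtain ⟨t, ht⟩ := exists_sec (EM := EM) p (L.symm 1)
  refine ⟨t, ?_⟩
  rw [ht]
  exact L.symm.map_ne_zero_iff.2 one_ne_zero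

theorem HomBundle.square_sec_apply (β : HomBundle ℝ E φ) (s t : Sec EM ℝ E) (m : M) :
    β.square.toLin (Square.sec s t) m = Square.tmul (β.toLin s m) (β.toLin t m) := by
  rw [β.square_sec]
  rfl

/-- Besides being part of the theorem, this ensures that every quotient in the local formula is
genuine and not the default value of `lineQuot`. -/
theorem HomBundle.square_ne_zero (β : HomBundle ℝ E φ)
    (hβ : ∀ (t : Sec EM ℝ E) (m : M), t (φ m) ≠ 0 → β.toLin t m ≠ 0)
    (t : Sec EM ℝ E) (m : M) (ht : t (φ m) ≠ 0) :
    β.square.toLin (Square.sec t t) m ≠ 0 := by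
  rw [β.square_sec_apply]
  exact Square.tmul_ne_zero (hβ t m ht) (hβ t m ht)

theorem Square.sec_eventuallyEq_smul {s₁ s₂ t : Sec EM ℝ E} {f₁ f₂ : SmoothFun EM M} {p : M}
    (h₁ : ∀ᶠ q in 𝓝 p, s₁ q = f₁ q • t q) (h₂ : ∀ᶠ q in 𝓝 p, s₂ q = f₂ q • t q) :
    ∀ᶠ q in 𝓝 p, Square.sec s₁ s₂ q = (f₁ * f₂ : SmoothFun EM M) q • Square.sec t t q := by
  filter_upwards [h₁, h₂] with q hq₁ hq₂
  change Square.tmul (s₁ q) (s₂ q) = (f₁ q * f₂ q) • Square.tmul (t q) (t q)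
  rw [hq₁, hq₂, Square.smul_tmul_smul]

/-! ### The logarithmic derivative and independence of the local formula -/

section

variable (𝒜 : HomLieAlgebroid FA A φ) (β : HomBundle ℝ E φ)
  (Dbar : Sec EM FA A →ₗ[ℝ] Sec EM ℝ (Square E) →ₗ[ℝ] Sec EM ℝ (Square E))

/-- The quotient `Dbar(x, t ⊗ t) / (β ⊗ β)(t ⊗ t)`. -/
noncomputable def logDeriv (x : Sec EM FA A) (t : Sec EM ℝ E) (m : M) : ℝ :=
  lineQuot (Dbar x (Square.sec t t) m) (β.square.toLin (Square.sec t t) m)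

/-- The value at `m` of the local formula for the square root, for `s = f t` near `φ(m)`. -/
noncomputable def sqrtValue (x : Sec EM FA A) (s : Sec EM ℝ E) (f : M → ℝ) (t : Sec EM ℝ E)
    (m : M) : E m :=
  𝒜.anchor.deriv x f m • β.toLin t m + ((1 / 2 : ℝ) * logDeriv β Dbar x t m) • β.toLin s m

end

variable {𝒜 : HomLieAlgebroid FA A φ} {β : HomBundle ℝ E φ}
  {Dbar : Sec EM FA A →ₗ[ℝ] Sec EM ℝ (Square E) →ₗ[ℝ] Sec EM ℝ (Square E)}

/-- Identities between quotients are proved through this lemma as identities between vectors of the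
square. -/
theorem logDeriv_eq {x : Sec EM FA A} {t : Sec EM ℝ E} {m : M} {c : ℝ}
    (h0 : β.square.toLin (Square.sec t t) m ≠ 0)
    (h : Dbar x (Square.sec t t) m = c • β.square.toLin (Square.sec t t) m) :
    logDeriv β Dbar x t m = c := by
  rw [logDeriv, h, lineQuot_smul _ _ h0]

theorem logDeriv_smul (x : Sec EM FA A) (t : Sec EM ℝ E) (m : M)
    (h0 : β.square.toLin (Square.sec t t) m ≠ 0) :
    logDeriv β Dbar x t m • β.square.toLin (Square.sec t t) m = Dbar x (Square.sec t t) m :=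
  lineQuot_smul_of_ne_zero _ _ h0

variable (hβ : ∀ (t : Sec EM ℝ E) (m : M), t (φ m) ≠ 0 → β.toLin t m ≠ 0)
  (hDbar : IsRepresentation 𝒜 β.square Dbar)

include hβ in
theorem logDeriv_add (x y : Sec EM FA A) (t : Sec EM ℝ E) (m : M) (ht : t (φ m) ≠ 0) :
    logDeriv β Dbar (x + y) t m = logDeriv β Dbar x t m + logDeriv β Dbar y t m := by
  have h0 := β.square_ne_zero hβ t m ht
  refine logDeriv_eq h0 ?_
  rw [add_smul, logDeriv_smul x t m h0, logDeriv_smul y t m h0, map_add]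
  rfl

include hβ in
theorem logDeriv_const_smul (c : ℝ) (x : Sec EM FA A) (t : Sec EM ℝ E) (m : M)
    (ht : t (φ m) ≠ 0) : logDeriv β Dbar (c • x) t m = c * logDeriv β Dbar x t m := by
  have h0 := β.square_ne_zero hβ t m ht
  refine logDeriv_eq h0 ?_
  rw [mul_smul, logDeriv_smul x t m h0, map_smul]
  rfl

include hβ hDbar in
theorem logDeriv_fun_smul (f : SmoothFun EM M) (x : Sec EM FA A) (t : Sec EM ℝ E) (m : M)
    (ht : t (φ m) ≠ 0) : logDeriv β Dbar (f • x) t m = f (φ m) * logDeriv β Dbar x t m := by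
  have h0 := β.square_ne_zero hβ t m ht
  refine logDeriv_eq h0 ?_
  rw [mul_smul, logDeriv_smul x t m h0, hDbar.fun_smul_left]
  rfl

include hβ in
theorem contMDiffAt_logDeriv (x : Sec EM FA A) (t : Sec EM ℝ E) (m : M) (ht : t (φ m) ≠ 0) :
    ContMDiffAt 𝓘(ℝ, EM) 𝓘(ℝ, ℝ) ∞ (logDeriv β Dbar x t) m :=
  contMDiffAt_lineQuot _ _ m (β.square_ne_zero hβ t m ht)

include hβ hDbar in
/-- The value of `Dbar(x, s₁ ⊗ s₂)` when `s₁` and `s₂` are multiples of `t` near `φ(m)`. -/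
theorem apply_square_sec {x : Sec EM FA A} {s₁ s₂ t : Sec EM ℝ E} {f₁ f₂ : SmoothFun EM M} {m : M}
    (ht : t (φ m) ≠ 0) (h₁ : ∀ᶠ q in 𝓝 (φ m), s₁ q = f₁ q • t q)
    (h₂ : ∀ᶠ q in 𝓝 (φ m), s₂ q = f₂ q • t q) :
    Dbar x (Square.sec s₁ s₂) m =
      (f₁ (φ m) * f₂ (φ m) * logDeriv β Dbar x t m + (f₁ (φ m) * 𝒜.anchor.deriv x f₂ m +
        f₂ (φ m) * 𝒜.anchor.deriv x f₁ m)) • Square.tmul (β.toLin t m) (β.toLin t m) := by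
  have h0 := β.square_ne_zero hβ t m ht
  rw [hDbar.apply_of_eventuallyEq_smul x _ _ _ m (Square.sec_eventuallyEq_smul h₁ h₂),
    ← logDeriv_smul x t m h0, AnchorMap.deriv_mul, smul_smul, ← add_smul, β.square_sec_apply]
  rfl

-- The heart of the construction: rescaling `t` by `g` shifts the half quotient by `ρ(x)[g] / g(φ
-- m)`, which the product rule for `f = f' * g` compensates.
include hβ hDbar in
theorem sqrtValue_eq_sqrtValue (x : Sec EM FA A) (s t t' : Sec EM ℝ E) (f f' : SmoothFun EM M)
    (m : M) (ht : t (φ m) ≠ 0) (ht' : t' (φ m) ≠ 0)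
    (h : ∀ᶠ q in 𝓝 (φ m), s q = f q • t q) (h' : ∀ᶠ q in 𝓝 (φ m), s q = f' q • t' q) :
    sqrtValue 𝒜 β Dbar x s f t m = sqrtValue 𝒜 β Dbar x s f' t' m := by
  obtain ⟨g, hg⟩ := exists_eventuallyEq_smul t' t (φ m) ht
  have hg0 : g (φ m) ≠ 0 := fun h0 => ht' (by rw [hg.self_of_nhds, h0, zero_smul])
  have hf : (f : M → ℝ) =ᶠ[𝓝 (φ m)] (f' * g : SmoothFun EM M) := by
    filter_upwards [h, h', hg, eventually_ne_zero t (φ m) ht] with q h1 h2 h3 h4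
    refine smul_left_injective ℝ h4 ?_
    change f q • t q = (f' q * g q) • t q
    rw [← h1, mul_smul, ← h3, h2]
  -- The factor `2` comes from differentiating `g * g`; it cancels the `1 / 2` of the local formula.
  have hQ : logDeriv β Dbar x t' m =
      logDeriv β Dbar x t m + 2 * (𝒜.anchor.deriv x g m / g (φ m)) := by
    refine logDeriv_eq (β.square_ne_zero hβ t' m ht') ?_
    rw [apply_square_sec hβ hDbar ht hg hg, β.square_sec_apply,
      β.apply_of_eventuallyEq_smul g t' t m hg, Square.smul_tmul_smul, smul_smul]
    congr 1
    field_simp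
    ring
  rw [sqrtValue, sqrtValue, AnchorMap.deriv_congr _ x hf, AnchorMap.deriv_mul, hQ,
    β.apply_of_eventuallyEq_smul f s t m h, β.apply_of_eventuallyEq_smul g t' t m hg,
    hf.self_of_nhds]
  change _ = _ + (_ : ℝ) • (f' (φ m) * g (φ m)) • _
  change _ + (_ : ℝ) • (f' (φ m) * g (φ m)) • _ = _
  simp only [smul_smul, ← add_smul]
  congr 1
  field_simp
  ring

/-! ### Construction of the square root -/

section

variable (𝒜 β Dbar)

/-- The values of the square root of `Dbar`. -/
noncomputable def sqrtFun (x : Sec EM FA A) (s : Sec EM ℝ E) (m : M) : E m :=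
  sqrtValue 𝒜 β Dbar x s
    (exists_eventuallyEq_smul s _ (φ m)
      (exists_sec_ne_zero (EM := EM) (E := E) (φ m)).choose_spec).choose
    (exists_sec_ne_zero (EM := EM) (E := E) (φ m)).choose m

end

-- Removes the arbitrary choices in `sqrtFun`: from here on `t` and `f` are picked to suit each
-- computation, in particular one `t` for several sections.
include hβ hDbar in
theorem sqrtFun_eq (x : Sec EM FA A) (s t : Sec EM ℝ E) (f : SmoothFun EM M) (m : M)
    (ht : t (φ m) ≠ 0) (h : ∀ᶠ q in 𝓝 (φ m), s q = f q • t q) :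
    sqrtFun 𝒜 β Dbar x s m = sqrtValue 𝒜 β Dbar x s f t m :=
  sqrtValue_eq_sqrtValue hβ hDbar x s _ t _ f m
    (exists_sec_ne_zero (EM := EM) (E := E) (φ m)).choose_spec ht
    (exists_eventuallyEq_smul s _ (φ m) (exists_sec_ne_zero (φ m)).choose_spec).choose_spec h

include hβ hDbar in
theorem sqrtFun_contMDiff (x : Sec EM FA A) (s : Sec EM ℝ E) :
    ContMDiff 𝓘(ℝ, EM) (𝓘(ℝ, EM).prod 𝓘(ℝ, ℝ)) ∞
      (fun m => TotalSpace.mk' ℝ (E := E) m (sqrtFun 𝒜 β Dbar x s m)) := by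
  intro m₀
  obtain ⟨t, ht⟩ := exists_sec_ne_zero (EM := EM) (E := E) (φ m₀)
  obtain ⟨f, hf⟩ := exists_eventuallyEq_smul s t (φ m₀) ht
  have h1 := (𝒜.anchor.deriv_contMDiff x f m₀).smul_section ((β.toLin t).contMDiff m₀)
  have h2 := ((contMDiffAt_const (c := (1 / 2 : ℝ))).mul
    (contMDiffAt_logDeriv (Dbar := Dbar) hβ x t m₀ ht)).smul_section ((β.toLin s).contMDiff m₀)
  refine (h1.add_section h2).congr_of_eventuallyEq ?_
  have hφ : ContinuousAt φ m₀ := φ.contMDiff.continuous.continuousAt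
  -- The factorization chosen at `m₀` must hold as a germ at `φ m` for all nearby `m`, hence
  -- `eventually_nhds`.
  filter_upwards [hφ.eventually hf.eventually_nhds,
    hφ.eventually (eventually_ne_zero t (φ m₀) ht)] with m hm1 hm2
  rw [sqrtFun_eq hβ hDbar x s t f m hm2 hm1]
  rfl

/-- The square root of `Dbar`. -/
noncomputable def sqrtRep (hβ : ∀ (t : Sec EM ℝ E) (m : M), t (φ m) ≠ 0 → β.toLin t m ≠ 0)
    (hDbar : IsRepresentation 𝒜 β.square Dbar) :
    Sec EM FA A →ₗ[ℝ] Sec EM ℝ E →ₗ[ℝ] Sec EM ℝ E :=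
  LinearMap.mk₂ ℝ (fun x s => ⟨sqrtFun 𝒜 β Dbar x s, sqrtFun_contMDiff hβ hDbar x s⟩)
    (fun x y s => by
      ext m
      obtain ⟨t, ht⟩ := exists_sec_ne_zero (EM := EM) (E := E) (φ m)
      obtain ⟨f, hf⟩ := exists_eventuallyEq_smul s t (φ m) ht
      change sqrtFun 𝒜 β Dbar (x + y) s m =
        sqrtFun 𝒜 β Dbar x s m + sqrtFun 𝒜 β Dbar y s m
      simp only [sqrtFun_eq hβ hDbar _ s t f m ht hf, sqrtValue, logDeriv_add hβ x y t m ht]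
      have h : 𝒜.anchor.deriv (x + y) f m = 𝒜.anchor.deriv x f m + 𝒜.anchor.deriv y f m :=
        congrArg (fun g : SmoothFun EM M => g m) (𝒜.anchor.action.map_add₂ x y f)
      rw [h]
      module)
    (fun c x s => by
      ext m
      obtain ⟨t, ht⟩ := exists_sec_ne_zero (EM := EM) (E := E) (φ m)
      obtain ⟨f, hf⟩ := exists_eventuallyEq_smul s t (φ m) ht
      change sqrtFun 𝒜 β Dbar (c • x) s m = c • sqrtFun 𝒜 β Dbar x s m
      simp only [sqrtFun_eq hβ hDbar _ s t f m ht hf, sqrtValue,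
        logDeriv_const_smul hβ c x t m ht]
      have h : 𝒜.anchor.deriv (c • x) f m = c * 𝒜.anchor.deriv x f m :=
        congrArg (fun g : SmoothFun EM M => g m) (𝒜.anchor.action.map_smul₂ c x f)
      rw [h]
      module)
    (fun x s₁ s₂ => by
      ext m
      obtain ⟨t, ht⟩ := exists_sec_ne_zero (EM := EM) (E := E) (φ m)
      obtain ⟨f₁, hf₁⟩ := exists_eventuallyEq_smul s₁ t (φ m) ht
      obtain ⟨f₂, hf₂⟩ := exists_eventuallyEq_smul s₂ t (φ m) ht
      have hf : ∀ᶠ q in 𝓝 (φ m), (s₁ + s₂) q = (f₁ + f₂ : SmoothFun EM M) q • t q := by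
        filter_upwards [hf₁, hf₂] with q hq₁ hq₂
        change s₁ q + s₂ q = (f₁ q + f₂ q) • t q
        rw [hq₁, hq₂, add_smul]
      change sqrtFun 𝒜 β Dbar x (s₁ + s₂) m =
        sqrtFun 𝒜 β Dbar x s₁ m + sqrtFun 𝒜 β Dbar x s₂ m
      rw [sqrtFun_eq hβ hDbar x _ t _ m ht hf, sqrtFun_eq hβ hDbar x _ t _ m ht hf₁,
        sqrtFun_eq hβ hDbar x _ t _ m ht hf₂, sqrtValue, sqrtValue, sqrtValue]
      have h : 𝒜.anchor.deriv x (f₁ + f₂ : SmoothFun EM M) m =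
          𝒜.anchor.deriv x f₁ m + 𝒜.anchor.deriv x f₂ m :=
        congrArg (fun g : SmoothFun EM M => g m) (map_add (𝒜.anchor.action x) f₁ f₂)
      have h' : β.toLin (s₁ + s₂) m = β.toLin s₁ m + β.toLin s₂ m :=
        congrArg (fun s : Sec EM ℝ E => s m) (map_add β.toLin s₁ s₂)
      rw [h, h']
      module)
    (fun c x s => by
      ext m
      obtain ⟨t, ht⟩ := exists_sec_ne_zero (EM := EM) (E := E) (φ m)
      obtain ⟨f, hf⟩ := exists_eventuallyEq_smul s t (φ m) ht
      have hcf : ∀ᶠ q in 𝓝 (φ m), (c • s) q = (c • f : SmoothFun EM M) q • t q := by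
        filter_upwards [hf] with q hq
        change c • s q = (c * f q) • t q
        rw [hq, mul_smul]
      change sqrtFun 𝒜 β Dbar x (c • s) m = c • sqrtFun 𝒜 β Dbar x s m
      rw [sqrtFun_eq hβ hDbar x _ t _ m ht hcf, sqrtFun_eq hβ hDbar x _ t _ m ht hf,
        sqrtValue, sqrtValue]
      have h : 𝒜.anchor.deriv x (c • f : SmoothFun EM M) m = c * 𝒜.anchor.deriv x f m :=
        congrArg (fun g : SmoothFun EM M => g m) (map_smul (𝒜.anchor.action x) c f)
      have h' : β.toLin (c • s) m = c • β.toLin s m :=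
        congrArg (fun s : Sec EM ℝ E => s m) (map_smul β.toLin c s)
      rw [h, h']
      module)

theorem sqrtRep_apply (x : Sec EM FA A) (s t : Sec EM ℝ E) (f : SmoothFun EM M) (m : M)
    (ht : t (φ m) ≠ 0) (h : ∀ᶠ q in 𝓝 (φ m), s q = f q • t q) :
    sqrtRep hβ hDbar x s m = sqrtValue 𝒜 β Dbar x s f t m :=
  sqrtFun_eq hβ hDbar x s t f m ht h

/-! ### The local formula and uniqueness -/

theorem sqrtRep_isSqrtOf : IsSqrtOf 𝒜 β Dbar (fun x s => sqrtRep hβ hDbar x s) := by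
  intro x s U f t hU hf ht hs m hm
  -- `f` is smooth only on `U`, while `sqrtRep_apply` takes a global function; the anchor derivative
  -- sees only the common germ.
  obtain ⟨g, hg⟩ := exists_smoothFun_eventuallyEq f U hU hf (φ m) hm
  have h : ∀ᶠ q in 𝓝 (φ m), s q = g q • t q := by
    filter_upwards [hg, hU.mem_nhds hm] with q hq hqU
    rw [← hq, hs q hqU]
  change sqrtRep hβ hDbar x s m = _
  rw [sqrtRep_apply hβ hDbar x s t g m (ht _ hm) h, sqrtValue, ← AnchorMap.deriv_congr _ x hg]
  rfl

/-- The local formula determines the square root. -/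
theorem IsSqrtOf.apply {D : Sec EM FA A → Sec EM ℝ E → Sec EM ℝ E} (hD : IsSqrtOf 𝒜 β Dbar D)
    (x : Sec EM FA A) (s t : Sec EM ℝ E) (f : SmoothFun EM M) (m : M)
    (ht : t (φ m) ≠ 0) (h : ∀ᶠ q in 𝓝 (φ m), s q = f q • t q) :
    D x s m = sqrtValue 𝒜 β Dbar x s f t m := by
  obtain ⟨U, hU, hUo, hm⟩ := eventually_nhds_iff.1 (h.and (eventually_ne_zero t (φ m) ht))
  exact hD x s U f t hUo f.contMDiff.contMDiffOn (fun p hp => (hU p hp).2)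
    (fun p hp => (hU p hp).1) m hm

theorem IsSqrtOf.eq_sqrtRep {D : Sec EM FA A → Sec EM ℝ E → Sec EM ℝ E}
    (hD : IsSqrtOf 𝒜 β Dbar D) (x : Sec EM FA A) (s : Sec EM ℝ E) :
    D x s = sqrtRep hβ hDbar x s := by
  ext m
  obtain ⟨t, ht⟩ := exists_sec_ne_zero (EM := EM) (E := E) (φ m)
  obtain ⟨f, hf⟩ := exists_eventuallyEq_smul s t (φ m) ht
  rw [hD.apply x s t f m ht hf, sqrtRep_apply hβ hDbar x s t f m ht hf]

/-! ### The tensor-square identity and the representation axioms -/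

/-- With `s₁ = f₁ t` and `s₂ = f₂ t` near `φ m`, everything is a multiple of `β(t) ⊗ β(t)`. The two
halves of the quotient add up to the whole, and the anchor terms form the product rule for `f₁ *
f₂`. -/
theorem sqrtRep_square (x : Sec EM FA A) (s₁ s₂ : Sec EM ℝ E) :
    Dbar x (Square.sec s₁ s₂) = Square.sec (sqrtRep hβ hDbar x s₁) (β.toLin s₂) +
      Square.sec (β.toLin s₁) (sqrtRep hβ hDbar x s₂) := by
  ext m
  obtain ⟨t, ht⟩ := exists_sec_ne_zero (EM := EM) (E := E) (φ m)
  obtain ⟨f₁, hf₁⟩ := exists_eventuallyEq_smul s₁ t (φ m) ht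
  obtain ⟨f₂, hf₂⟩ := exists_eventuallyEq_smul s₂ t (φ m) ht
  change _ = Square.tmul (sqrtRep hβ hDbar x s₁ m) (β.toLin s₂ m) +
    Square.tmul (β.toLin s₁ m) (sqrtRep hβ hDbar x s₂ m)
  rw [apply_square_sec hβ hDbar ht hf₁ hf₂, sqrtRep_apply hβ hDbar x s₁ t f₁ m ht hf₁,
    sqrtRep_apply hβ hDbar x s₂ t f₂ m ht hf₂, sqrtValue, sqrtValue,
    β.apply_of_eventuallyEq_smul f₁ s₁ t m hf₁, β.apply_of_eventuallyEq_smul f₂ s₂ t m hf₂]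
  simp only [smul_smul, ← add_smul, Square.smul_tmul_smul]
  congr 1
  ring

theorem sqrtRep_fun_smul_left (f : SmoothFun EM M) (x : Sec EM FA A) (s : Sec EM ℝ E) :
    sqrtRep hβ hDbar (f • x) s = pullback φ f • sqrtRep hβ hDbar x s := by
  ext m
  obtain ⟨t, ht⟩ := exists_sec_ne_zero (EM := EM) (E := E) (φ m)
  obtain ⟨g, hg⟩ := exists_eventuallyEq_smul s t (φ m) ht
  change _ = f (φ m) • sqrtRep hβ hDbar x s m
  simp only [sqrtRep_apply hβ hDbar _ s t g m ht hg, sqrtValue,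
    logDeriv_fun_smul hβ hDbar f x t m ht, AnchorMap.deriv_smul_left]
  module

theorem sqrtRep_leibniz (x : Sec EM FA A) (f : SmoothFun EM M) (s : Sec EM ℝ E) :
    sqrtRep hβ hDbar x (f • s) =
      pullback φ f • sqrtRep hβ hDbar x s + 𝒜.anchor.action x f • β.toLin s := by
  ext m
  obtain ⟨t, ht⟩ := exists_sec_ne_zero (EM := EM) (E := E) (φ m)
  obtain ⟨g, hg⟩ := exists_eventuallyEq_smul s t (φ m) ht
  have hfg : ∀ᶠ q in 𝓝 (φ m), (f • s) q = (f * g : SmoothFun EM M) q • t q := by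
    filter_upwards [hg] with q hq
    change f q • s q = (f q * g q) • t q
    rw [hq, mul_smul]
  change _ = f (φ m) • sqrtRep hβ hDbar x s m + 𝒜.anchor.deriv x f m • β.toLin s m
  rw [sqrtRep_apply hβ hDbar x _ t _ m ht hfg, sqrtRep_apply hβ hDbar x s t g m ht hg,
    sqrtValue, sqrtValue, AnchorMap.deriv_mul, β.toLin_smul_apply,
    β.apply_of_eventuallyEq_smul g s t m hg]
  module

-- Polarization on a line: taking both sections equal to a suitable `t` gives `2 Δ(t) = 0` at `m`,
-- and then pairing any `s` with that `t` leaves only `Δ(s) ⊗ β²(t) = 0`. No linearity of `Δ` is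
-- needed.
include hβ in
theorem eq_zero_of_square_eq_zero (Δ : Sec EM ℝ E → Sec EM ℝ E)
    (h : ∀ s t, Square.sec (Δ s) (β.toLin (β.toLin t)) +
      Square.sec (β.toLin (β.toLin s)) (Δ t) = 0) (s : Sec EM ℝ E) : Δ s = 0 := by
  have h' : ∀ s t m, Square.tmul (Δ s m) (β.toLin (β.toLin t) m) +
      Square.tmul (β.toLin (β.toLin s) m) (Δ t m) = 0 := fun s t m =>
    congrArg (fun σ : Sec EM ℝ (Square E) => σ m) (h s t)
  ext m
  change Δ s m = 0
  -- The value of `β²(t)` at `m` is governed by `t` at `φ (φ m)`.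
  obtain ⟨t, ht⟩ := exists_sec_ne_zero (EM := EM) (E := E) (φ (φ m))
  have hb : β.toLin (β.toLin t) m ≠ 0 := hβ _ _ (hβ _ _ ht)
  have h1 : Δ t m = 0 := by
    by_contra h0
    obtain ⟨c, hc⟩ : ∃ c : ℝ, Δ t m = c • β.toLin (β.toLin t) m :=
      ⟨_, (lineQuot_smul_of_ne_zero _ _ hb).symm⟩
    have h2 := h' t t m
    rw [hc, Square.smul_tmul, Square.tmul_smul, ← add_smul] at h2
    have h3 : c + c = 0 := (smul_eq_zero.1 h2).resolve_right (Square.tmul_ne_zero hb hb)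
    have h4 : c = 0 := by linarith
    exact h0 (by rw [hc, h4, zero_smul])
  by_contra h0
  have h2 := h' s t m
  rw [h1, Square.tmul_zero, add_zero] at h2
  exact Square.tmul_ne_zero h0 hb h2

theorem sqrtRep_equivariant (x : Sec EM FA A) (s : Sec EM ℝ E) :
    sqrtRep hβ hDbar (𝒜.α.toLin x) (β.toLin s) = β.toLin (sqrtRep hβ hDbar x s) := by
  rw [← sub_eq_zero]
  refine eq_zero_of_square_eq_zero hβ
    (fun s => sqrtRep hβ hDbar (𝒜.α.toLin x) (β.toLin s) - β.toLin (sqrtRep hβ hDbar x s))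
    (fun s t => ?_) s
  have h := hDbar.homLieRep.equivariant x (Square.sec s t)
  -- Expanding both sides of equivariance of `Dbar` on `s ⊗ t` gives the hypothesis on the defect,
  -- up to regrouping.
  rw [β.square_sec, sqrtRep_square hβ hDbar, sqrtRep_square hβ hDbar, map_add, β.square_sec,
    β.square_sec] at h
  ext m
  have hm := congrArg (fun σ : Sec EM ℝ (Square E) => σ m) h
  change Square.tmul _ _ + Square.tmul _ _ = Square.tmul _ _ + Square.tmul _ _ at hm
  change Square.tmul ((_ : E m) - _) _ + Square.tmul _ ((_ : E m) - _) = 0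
  rw [Square.sub_tmul, Square.tmul_sub]
  refine Eq.trans ?_ (sub_eq_zero.2 hm)
  abel

theorem sqrtRep_bracket (x y : Sec EM FA A) (s : Sec EM ℝ E) :
    sqrtRep hβ hDbar (𝒜.bracket x y) (β.toLin s) =
      sqrtRep hβ hDbar (𝒜.α.toLin x) (sqrtRep hβ hDbar y s) -
        sqrtRep hβ hDbar (𝒜.α.toLin y) (sqrtRep hβ hDbar x s) := by
  rw [← sub_eq_zero]
  refine eq_zero_of_square_eq_zero hβ
    (fun s => sqrtRep hβ hDbar (𝒜.bracket x y) (β.toLin s) -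
      (sqrtRep hβ hDbar (𝒜.α.toLin x) (sqrtRep hβ hDbar y s) -
        sqrtRep hβ hDbar (𝒜.α.toLin y) (sqrtRep hβ hDbar x s)))
    (fun s t => ?_) s
  have h := hDbar.homLieRep.bracket x y (Square.sec s t)
  -- Equivariance rewrites the mixed terms as tensors of `β(∇(x, ·))` with `β(∇(y, ·))`; their sum
  -- is symmetric in `x` and `y`, so it drops out of the difference.
  simp only [β.square_sec, sqrtRep_square hβ hDbar, map_add, sqrtRep_equivariant] at h
  ext m
  have hm := congrArg (fun σ : Sec EM ℝ (Square E) => σ m) h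
  change Square.tmul _ _ + Square.tmul _ _ =
    Square.tmul _ _ + Square.tmul _ _ + (Square.tmul _ _ + Square.tmul _ _) -
    (Square.tmul _ _ + Square.tmul _ _ + (Square.tmul _ _ + Square.tmul _ _)) at hm
  change Square.tmul ((_ : E m) - ((_ : E m) - _)) _ +
    Square.tmul _ ((_ : E m) - ((_ : E m) - _)) = 0
  simp only [Square.sub_tmul, Square.tmul_sub]
  refine Eq.trans ?_ (sub_eq_zero.2 hm)
  abel

theorem sqrtRep_isRepresentation : IsRepresentation 𝒜 β (sqrtRep hβ hDbar) where
  fun_smul_left := sqrtRep_fun_smul_left hβ hDbar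
  leibniz := sqrtRep_leibniz hβ hDbar
  homLieRep :=
    { equivariant := sqrtRep_equivariant hβ hDbar
      bracket := sqrtRep_bracket hβ hDbar }

end SquareRootRepresentation

end HomAlgebroid

theorem mainTheorem7
    {EM : Type*} [NormedAddCommGroup EM] [NormedSpace ℝ EM] [FiniteDimensional ℝ EM]
    {M : Type*} [TopologicalSpace M] [T2Space M] [ChartedSpace EM M] [IsManifold 𝓘(ℝ, EM) ∞ M]
    {FA : Type*} [NormedAddCommGroup FA] [NormedSpace ℝ FA] [FiniteDimensional ℝ FA]
    {A : M → Type*} [TopologicalSpace (TotalSpace FA A)]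
    [∀ m, AddCommGroup (A m)] [∀ m, Module ℝ (A m)] [∀ m, TopologicalSpace (A m)]
    [FiberBundle FA A] [VectorBundle ℝ FA A] [ContMDiffVectorBundle ∞ FA A 𝓘(ℝ, EM)]
    {E : M → Type*} [TopologicalSpace (TotalSpace ℝ E)]
    [∀ m, AddCommGroup (E m)] [∀ m, Module ℝ (E m)] [∀ m, TopologicalSpace (E m)]
    [FiberBundle ℝ E] [VectorBundle ℝ ℝ E] [ContMDiffVectorBundle ∞ ℝ E 𝓘(ℝ, EM)]
    (φ : C^∞⟮𝓘(ℝ, EM), M; 𝓘(ℝ, EM), M⟯)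
    (𝒜 : HomLieAlgebroid FA A φ)
    (β : HomBundle ℝ E φ)
    (hβ : ∀ (t : Sec EM ℝ E) (m : M), t (φ m) ≠ 0 → β.toLin t m ≠ 0)
    (Dbar : Sec EM FA A →ₗ[ℝ] Sec EM ℝ (Square E) →ₗ[ℝ] Sec EM ℝ (Square E))
    (hDbar : IsRepresentation 𝒜 β.square Dbar) :
    (∀ (t : Sec EM ℝ E) (m : M), t (φ m) ≠ 0 → β.square.toLin (Square.sec t t) m ≠ 0) ∧
    ∃ D : Sec EM FA A →ₗ[ℝ] Sec EM ℝ E →ₗ[ℝ] Sec EM ℝ E,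
      IsSqrtOf 𝒜 β Dbar (fun x s => D x s) ∧
      (∀ D' : Sec EM FA A → Sec EM ℝ E → Sec EM ℝ E,
        IsSqrtOf 𝒜 β Dbar D' → ∀ x s, D' x s = D x s) ∧
      IsRepresentation 𝒜 β D ∧
      ∀ (x : Sec EM FA A) (s₁ s₂ : Sec EM ℝ E),
        Dbar x (Square.sec s₁ s₂) =
          Square.sec (D x s₁) (β.toLin s₂) + Square.sec (β.toLin s₁) (D x s₂) :=
  ⟨β.square_ne_zero hβ, sqrtRep hβ hDbar, sqrtRep_isSqrtOf hβ hDbar,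
    fun _ hD' => hD'.eq_sqrtRep hβ hDbar, sqrtRep_isRepresentation hβ hDbar,
    sqrtRep_square hβ hDbar⟩
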